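/- Let $\Gamma$ be a finite connected simple graph that has no induced subgraph isomorphic to $C_4$ (the cycle with $4$ edges) or to $L_3$ (the path with $3$ edges, on $4$ vertices). Let $G$ be the right-angled Artin group with defining graph $\Gamma$, that is, the group with the presentation $$G=\langle V(\Gamma)\mid ab=ba \text{ for every edge } \{a,b\} \text{ of } \Gamma\rangle .$$ Then $G$ admits a regular left-order: there is a strict total order $\prec$ on $G$, with $a\prec b \Leftrightarrow ca\prec cb$ for all $a,b,c\in G$, together with a finite set $X$, a surjective monoid homomorphism $\pi\colon X^*\to G$ and a regular language $\mathcal L\subseteq X^*$ (one accepted by a finite state automaton), such that $\pi(\mathcal L)$ is the positive cone $\{g\in G\mid 1\prec g\}$. -/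

import Mathlib

/-- The relators `a * b * (b * a)⁻¹`, one for each pair of adjacent vertices `a`, `b`. -/
def raagRelators {V : Type*} (Γ : SimpleGraph V) : Set (FreeGroup V) :=
  {r | ∃ a b : V, Γ.Adj a b ∧
    r = FreeGroup.of a * FreeGroup.of b * (FreeGroup.of b * FreeGroup.of a)⁻¹}

/-- The right-angled Artin group with defining graph `Γ`: it is generated by the vertices of `Γ`,
with the relation `a * b = b * a` for each edge `{a, b}` of `Γ` (an Artin group all of whose edges
have label `2`). -/
abbrev RightAngledArtinGroup {V : Type*} (Γ : SimpleGraph V) : Type _ :=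
  PresentedGroup (raagRelators Γ)

/-- `lt` is a left-order on `G`: a strict total order with `a ≺ b ↔ c * a ≺ c * b`. -/
structure IsLeftOrder {G : Type*} [Group G] (lt : G → G → Prop) : Prop where
  irrefl : ∀ a, ¬ lt a a
  trans : ∀ a b c, lt a b → lt b c → lt a c
  total : ∀ a b, lt a b ∨ a = b ∨ lt b a
  mul_left_iff : ∀ a b c, lt a b ↔ lt (c * a) (c * b)

/-- The positive cone of an order: the set of elements greater than `1`. -/
def positiveCone {G : Type*} [Group G] (lt : G → G → Prop) : Set G :=
  {g | lt 1 g}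

/-- A subset `S` of a group `G` is represented by a regular language: for some finite (monoid)
generating set of `G`, that is, a finite alphabet `X` with a surjective monoid homomorphism
`π : X* → G`, there is a regular language `L ⊆ X*` that evaluates onto `S`, i.e. `π(L) = S`. -/
def IsRegularSubset {G : Type*} [Group G] (S : Set G) : Prop :=
  ∃ (X : Type) (_ : Finite X) (π : FreeMonoid X →* G), Function.Surjective π ∧
    ∃ L : Language X, L.IsRegular ∧ ∀ g : G, g ∈ S ↔ ∃ w ∈ L, π (FreeMonoid.ofList w) = g

/-- A regular left-order: a left-order whose positive cone is represented by a regular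
language. -/
def IsRegularLeftOrder {G : Type*} [Group G] (lt : G → G → Prop) : Prop :=
  IsLeftOrder lt ∧ IsRegularSubset (positiveCone lt)

/-!
A vertex of maximal degree in a connected graph without induced `C₄` and `L₃` is adjacent to all the
others. It generates an infinite cyclic direct factor of `G`, and the other factor is the free
product of the groups of smaller connected graphs of the same kind. By induction it is enough to
order `(*ᵢ Gᵢ) × ℤ`, given regular orders of the groups `Gᵢ`.

Fix a linear order on the indices and let the weight `W` of a reduced word be the sum of the signs
of its syllables, plus `1` for each ascent and `-1` for each descent between consecutive indices,
where the index sequence is bordered by `⊤` on both sides. Then `W` is odd on nontrivial elements,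
`W g⁻¹ = -W g`, and `W` is additive up to an error of at most `1`; therefore the pairs `(g, k)` with
`W g + 2 * k > 0` form a positive cone. Up to positive powers of the generator of `ℤ`, such a pair
satisfies `W g + 2 * k = 1`. The factor `ℤ` can compensate for the contribution of every syllable as
soon as it is read, so that the solutions are the products of labels along the paths of a finite
automaton that only remembers the last index.
-/

open scoped Pointwise Computability

open Multiplicative (ofAdd)

section Regular

variable {α : Type*} {L K : Language α}

theorem isRegular_of_finite (hL : {x | x ∈ L}.Finite) : L.IsRegular := by
  refine .of_finite_range_leftQuotient ?_
  have hsuffix : {y | ∃ x ∈ L, y <:+ x}.Finite := by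
    refine (hL.biUnion fun x _ => x.tails.finite_toSet).subset ?_
    rintro y ⟨x, hx, hyx⟩
    exact Set.mem_biUnion hx ((List.mem_tails _ _).2 hyx)
  refine hsuffix.finite_subsets.subset ?_
  rintro _ ⟨x, rfl⟩ y hy
  exact ⟨x ++ y, hy, List.suffix_append x y⟩

theorem finite_range_iSup_leftQuotient (hL : L.IsRegular) :
    (Set.range fun C : Set (List α) => ⨆ c ∈ C, L.leftQuotient c).Finite := by
  refine (hL.finite_range_leftQuotient.finite_subsets.image sSup).subset ?_
  rintro _ ⟨C, rfl⟩
  exact ⟨L.leftQuotient '' C, Set.image_subset_range _ _, sSup_image⟩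

theorem leftQuotient_mul (L K : Language α) (x : List α) :
    (L * K).leftQuotient x =
      L.leftQuotient x * K + ⨆ c ∈ {c | ∃ a ∈ L, a ++ c = x}, K.leftQuotient c := by
  ext y
  simp only [Language.mem_leftQuotient, Language.mem_mul, Language.mem_add, Language.mem_iSup,
    List.append_eq_append_iff, Set.mem_ofPred_eq, exists_prop]
  constructor
  · rintro ⟨a, ha, b, hb, ⟨c, rfl, rfl⟩ | ⟨c, rfl, rfl⟩⟩
    · exact Or.inr ⟨c, ⟨a, ha, rfl⟩, hb⟩
    · exact Or.inl ⟨c, ha, b, hb, rfl⟩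
  · rintro (⟨c, hc, b, hb, rfl⟩ | ⟨c, ⟨a, ha, rfl⟩, hc⟩)
    · exact ⟨x ++ c, hc, b, hb, Or.inr ⟨c, rfl, rfl⟩⟩
    · exact ⟨a, ha, c ++ y, hc, Or.inl ⟨c, rfl, rfl⟩⟩

theorem isRegular_mul (hL : L.IsRegular) (hK : K.IsRegular) : (L * K).IsRegular := by
  refine .of_finite_range_leftQuotient ?_
  refine (hL.finite_range_leftQuotient.image2 (fun A B => A * K + B)
    (finite_range_iSup_leftQuotient hK)).subset ?_
  rintro _ ⟨x, rfl⟩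
  exact ⟨_, ⟨x, rfl⟩, _, ⟨_, rfl⟩, (leftQuotient_mul L K x).symm⟩

theorem leftQuotient_kstar (L : Language α) {x : List α} (hx : x ≠ []) :
    L∗.leftQuotient x = (⨆ c ∈ {c | ∃ a ∈ L∗, a ++ c = x}, L.leftQuotient c) * L∗ := by
  ext y
  simp only [Language.mem_leftQuotient, Language.mem_mul, Language.mem_iSup, Set.mem_ofPred_eq,
    exists_prop]
  constructor
  · rw [Language.mem_kstar]
    rintro ⟨S, hxy, hS⟩
    induction S generalizing x with
    | nil => simp_all
    | cons s S ih =>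
      rw [List.forall_mem_cons] at hS
      rcases List.append_eq_append_iff.1 hxy with ⟨c, rfl, rfl⟩ | ⟨c, rfl, h⟩
      · exact ⟨c, ⟨x, ⟨[], L.nil_mem_kstar, rfl⟩, hS.1⟩, S.flatten, Language.join_mem_kstar hS.2,
          rfl⟩
      · rcases eq_or_ne c [] with rfl | hc
        · exact ⟨[], ⟨s, ⟨[], L.nil_mem_kstar, by simp⟩, by simpa using hS.1⟩, y,
            Language.mem_kstar.2 ⟨S, h.symm, hS.2⟩, rfl⟩
        · obtain ⟨z, ⟨d, ⟨a, ha, rfl⟩, hd⟩, w, hw, rfl⟩ := ih hc h.symm hS.2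
          have hsa : s ++ a ∈ L∗ :=
            mul_kstar_le_kstar (a := L) (Language.append_mem_mul hS.1 ha)
          exact ⟨z, ⟨d, ⟨s ++ a, hsa, by simp⟩, hd⟩, w, hw, rfl⟩
  · rintro ⟨z, ⟨c, ⟨a, ha, rfl⟩, hc⟩, w, hw, rfl⟩
    have hacz : a ++ (c ++ z) ∈ L∗ := kstar_mul_le_kstar (a := L) (Language.append_mem_mul ha hc)
    have haczw : a ++ (c ++ z) ++ w ∈ L∗ * L∗ := Language.append_mem_mul hacz hw
    simpa [kstar_mul_kstar] using haczw

theorem isRegular_kstar (hL : L.IsRegular) : L∗.IsRegular := by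
  refine .of_finite_range_leftQuotient ?_
  refine (((finite_range_iSup_leftQuotient hL).image (· * L∗)).insert L∗).subset ?_
  rintro _ ⟨x, rfl⟩
  rcases eq_or_ne x [] with rfl | hx
  · exact Or.inl rfl
  · exact Or.inr ⟨_, ⟨_, rfl⟩, (leftQuotient_kstar L hx).symm⟩

end Regular

/-- The rational subsets of a monoid: the smallest family of subsets that contains the finite ones
and is closed under unions, products and generated submonoids. -/
inductive IsRational {M : Type*} [Monoid M] : Set M → Prop
  | of_finite {S : Set M} (hS : S.Finite) : IsRational S
  | union {S T : Set M} (hS : IsRational S) (hT : IsRational T) : IsRational (S ∪ T)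
  | mul {S T : Set M} (hS : IsRational S) (hT : IsRational T) : IsRational (S * T)
  | closure {S : Set M} (hS : IsRational S) : IsRational (Submonoid.closure S : Set M)

namespace IsRational

section Monoid

variable {M N : Type*} [Monoid M] [Monoid N]

theorem map (φ : M →* N) {S : Set M} (hS : IsRational S) : IsRational (φ '' S) := by
  induction hS with
  | of_finite hS => exact .of_finite (hS.image φ)
  | union _ _ ihS ihT => rw [Set.image_union]; exact ihS.union ihT
  | mul _ _ ihS ihT => rw [Set.image_mul]; exact ihS.mul ihT
  | closure _ ih => rw [← Submonoid.coe_map, MonoidHom.map_mclosure]; exact ih.closure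

theorem exists_image_eq {φ : M →* N} (hφ : Function.Surjective φ) {S : Set N} (hS : IsRational S) :
    ∃ T, IsRational T ∧ φ '' T = S := by
  induction hS with
  | of_finite hS =>
    exact ⟨Function.surjInv hφ '' _, .of_finite (hS.image _), by
      simp only [Set.image_image, Function.surjInv_eq, Set.image_id']⟩
  | union _ _ ihS ihT =>
    obtain ⟨⟨S, hS, rfl⟩, T, hT, rfl⟩ := And.intro ihS ihT
    exact ⟨_, hS.union hT, Set.image_union φ S T⟩
  | mul _ _ ihS ihT =>
    obtain ⟨⟨S, hS, rfl⟩, T, hT, rfl⟩ := And.intro ihS ihT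
    exact ⟨_, hS.mul hT, Set.image_mul φ⟩
  | closure _ ih =>
    obtain ⟨S, hS, rfl⟩ := ih
    exact ⟨_, hS.closure, by rw [← Submonoid.coe_map, MonoidHom.map_mclosure]⟩

end Monoid

theorem inv {G : Type*} [Group G] {S : Set G} (hS : IsRational S) : IsRational S⁻¹ := by
  induction hS with
  | of_finite hS => exact .of_finite hS.inv
  | union _ _ ihS ihT => rw [Set.union_inv]; exact ihS.union ihT
  | mul _ _ ihS ihT => rw [mul_inv_rev]; exact ihT.mul ihS
  | closure _ ih => rw [← Submonoid.coe_inv, ← Submonoid.closure_inv]; exact ih.closure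

/-- A subset of the free monoid on `α`, regarded as a language over the alphabet `α`. -/
def toLanguage {α : Type*} (S : Set (FreeMonoid α)) : Language α :=
  FreeMonoid.ofList ⁻¹' S

theorem toLanguage_union {α : Type*} (S T : Set (FreeMonoid α)) :
    toLanguage (S ∪ T) = toLanguage S + toLanguage T :=
  rfl

theorem toLanguage_mul {α : Type*} (S T : Set (FreeMonoid α)) :
    toLanguage (S * T) = toLanguage S * toLanguage T :=
  rfl

theorem toLanguage_closure {α : Type*} (S : Set (FreeMonoid α)) :
    toLanguage (Submonoid.closure S : Set (FreeMonoid α)) = (toLanguage S)∗ := by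
  ext l
  rw [Language.mem_kstar]
  constructor
  · intro hl
    obtain ⟨L, hL, hLl⟩ := Submonoid.exists_list_of_mem_closure (x := FreeMonoid.ofList l) hl
    exact ⟨L.map FreeMonoid.toList, by rw [← FreeMonoid.toList_prod, hLl, FreeMonoid.toList_ofList],
      List.forall_mem_map.2 hL⟩
  · rintro ⟨L, rfl, hL⟩
    change FreeMonoid.ofList L.flatten ∈ Submonoid.closure S
    rw [FreeMonoid.ofList_flatten]
    exact Submonoid.list_prod_mem _ <|
      List.forall_mem_map.2 fun y hy => Submonoid.subset_closure (hL y hy)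

theorem isRegular_toLanguage {α : Type*} {S : Set (FreeMonoid α)} (hS : IsRational S) :
    (toLanguage S).IsRegular := by
  induction hS with
  | of_finite hS => exact isRegular_of_finite (hS.preimage FreeMonoid.ofList.injective.injOn)
  | union _ _ ihS ihT => rw [toLanguage_union]; exact ihS.add ihT
  | mul _ _ ihS ihT => rw [toLanguage_mul]; exact isRegular_mul ihS ihT
  | closure _ ih => rw [toLanguage_closure]; exact isRegular_kstar ih

theorem isRegularSubset {G : Type*} [Group G] [hG : Group.FG G] {S : Set G} (hS : IsRational S) :
    IsRegularSubset S := by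
  obtain ⟨α, hα, φ, hφ⟩ :=
    Monoid.fg_iff_exists_freeGroup_hom_surjective_finite.1 (Group.fg_iff_monoid_fg.1 hG)
  obtain ⟨T, hT, rfl⟩ := hS.exists_image_eq hφ
  exact ⟨α, hα, φ, hφ, _, hT.isRegular_toLanguage, fun g => Iff.rfl⟩

end IsRational

section Path

variable {Q M : Type*} [Monoid M]

/-- `PathThrough E T q p a` says that `a` is the product of the labels along a path with at least
one edge from `p` to `q` all of whose interior vertices lie in `T`, in the labelled graph in which
every element of `E r s` labels an edge from `r` to `s`. -/
inductive PathThrough (E : Q → Q → Set M) (T : Set Q) (q : Q) : Q → M → Prop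
  | single {p : Q} {a : M} (ha : a ∈ E p q) : PathThrough E T q p a
  | cons {p r : Q} {a b : M} (ha : a ∈ E p r) (hr : r ∈ T) (hb : PathThrough E T q r b) :
      PathThrough E T q p (a * b)

/-- The set of products of labels along the paths of `PathThrough`. -/
def pathLabels (E : Q → Q → Set M) (T : Set Q) (p q : Q) : Set M :=
  {a | PathThrough E T q p a}

variable {E : Q → Q → Set M} {S T : Set Q} {p q r : Q} {a b : M}

theorem pathLabels_mono (hST : S ⊆ T) : pathLabels E S p q ⊆ pathLabels E T p q := by
  intro a ha
  induction ha with
  | single ha => exact .single ha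
  | cons ha hr _ ih => exact .cons ha (hST hr) ih

theorem PathThrough.mul (ha : PathThrough E T r p a) (hr : r ∈ T) (hb : PathThrough E T q r b) :
    PathThrough E T q p (a * b) := by
  induction ha with
  | single ha => exact .cons ha hr hb
  | cons ha hs _ ih => rw [mul_assoc]; exact .cons ha hs ih

theorem PathThrough.closure_mul (hr : r ∈ T) (ha : a ∈ Submonoid.closure (pathLabels E T r r))
    (hb : PathThrough E T q r b) : PathThrough E T q r (a * b) := by
  induction ha using Submonoid.closure_induction_left with
  | one => rwa [one_mul]
  | mul_left c hc a _ ih => rw [mul_assoc]; exact PathThrough.mul hc hr ih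

theorem pathLabels_empty : pathLabels E ∅ p q = E p q := by
  ext a
  refine ⟨fun ha => ?_, .single⟩
  cases ha with
  | single ha => exact ha
  | cons _ hr _ => exact hr.elim

/-- Cut a path at its visits to `r`. -/
theorem pathLabels_insert :
    pathLabels E (insert r T) p q = pathLabels E T p q ∪
      pathLabels E T p r * Submonoid.closure (pathLabels E T r r) * pathLabels E T r q := by
  have hT : ∀ s t, pathLabels E T s t ⊆ pathLabels E (insert r T) s t := fun s t =>
    pathLabels_mono (Set.subset_insert r T)
  apply Set.Subset.antisymm
  · intro a ha
    induction ha with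
    | single ha => exact Or.inl (.single ha)
    | @cons p s a b ha hs _ ih =>
      rcases hs with rfl | hs
      · rcases ih with hb | ⟨_, ⟨c, hc, d, hd, rfl⟩, e, he, rfl⟩
        · exact Or.inr ⟨a * 1, ⟨a, .single ha, 1, one_mem _, rfl⟩, b, hb, by simp⟩
        · refine Or.inr ⟨a * (c * d), ⟨a, .single ha, c * d, ?_, rfl⟩, e, he, mul_assoc _ _ _⟩
          exact mul_mem (Submonoid.subset_closure hc) hd
      · rcases ih with hb | ⟨_, ⟨c, hc, d, hd, rfl⟩, e, he, rfl⟩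
        · exact Or.inl (.cons ha hs hb)
        · exact Or.inr ⟨a * c * d, ⟨a * c, .cons ha hs hc, d, hd, rfl⟩, e, he, by
            simp only [mul_assoc]⟩
  · rintro a (ha | ⟨_, ⟨b, hb, c, hc, rfl⟩, d, hd, rfl⟩)
    · exact hT p q ha
    · have hr : r ∈ insert r T := Set.mem_insert r T
      have hc' := Submonoid.closure_mono (hT r r) hc
      change PathThrough E (insert r T) q p (b * c * d)
      rw [mul_assoc]
      exact PathThrough.mul (hT p r hb) hr (.closure_mul hr hc' (hT r q hd))

theorem isRational_pathLabels (hT : T.Finite) (hE : ∀ p q, IsRational (E p q)) (p q : Q) :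
    IsRational (pathLabels E T p q) := by
  induction T, hT using Set.Finite.induction_on generalizing p q with
  | empty => rw [pathLabels_empty]; exact hE p q
  | @insert r T _ _ ih =>
    rw [pathLabels_insert]
    exact (ih p q).union (((ih p r).mul (ih r r).closure).mul (ih r q))

end Path

/-- `P` is the positive cone of some left-order. -/
structure IsPositiveCone {G : Type*} [Group G] (P : Set G) : Prop where
  one_notMem : 1 ∉ P
  mul_mem : ∀ {a b}, a ∈ P → b ∈ P → a * b ∈ P
  mem_or_inv_mem : ∀ {a}, a ≠ 1 → a ∈ P ∨ a⁻¹ ∈ P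

namespace IsPositiveCone

variable {G : Type*} [Group G] {P : Set G}

theorem inv_notMem (hP : IsPositiveCone P) {a : G} (ha : a ∈ P) : a⁻¹ ∉ P := fun h =>
  hP.one_notMem (by simpa using hP.mul_mem ha h)

theorem isLeftOrder (hP : IsPositiveCone P) : IsLeftOrder fun a b : G => a⁻¹ * b ∈ P where
  irrefl a h := hP.one_notMem (by simpa using h)
  trans a b c hab hbc := by simpa [mul_assoc] using hP.mul_mem hab hbc
  total a b := by
    rcases eq_or_ne a b with hab | hab
    · exact .inr (.inl hab)
    · rcases hP.mem_or_inv_mem (mt inv_mul_eq_one.1 hab) with h | h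
      · exact .inl h
      · exact .inr (.inr (by simpa using h))
  mul_left_iff a b c := by simp [mul_assoc]

theorem map {H : Type*} [Group H] (hP : IsPositiveCone P) (e : G ≃* H) :
    IsPositiveCone (e '' P) where
  one_notMem := by
    rintro ⟨x, hx, h⟩
    exact hP.one_notMem ((map_eq_one_iff e e.injective).1 h ▸ hx)
  mul_mem := by
    rintro _ _ ⟨x, hx, rfl⟩ ⟨y, hy, rfl⟩
    exact ⟨x * y, hP.mul_mem hx hy, map_mul e x y⟩
  mem_or_inv_mem {a} ha := by
    rcases hP.mem_or_inv_mem (a := e.symm a) (by simpa using ha) with h | h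
    · exact .inl ⟨_, h, e.apply_symm_apply a⟩
    · exact .inr ⟨_, h, by simp⟩

end IsPositiveCone

/-- The group has a left-order whose positive cone is a rational subset. -/
def HasRationalPositiveCone (G : Type*) [Group G] : Prop :=
  ∃ P : Set G, IsPositiveCone P ∧ IsRational P

theorem HasRationalPositiveCone.of_mulEquiv {G H : Type*} [Group G] [Group H]
    (hG : HasRationalPositiveCone G) (e : G ≃* H) : HasRationalPositiveCone H := by
  obtain ⟨P, hP, hr⟩ := hG
  exact ⟨e '' P, hP.map e, hr.map e.toMonoidHom⟩

open Classical in
/-- The sign of an element with respect to a positive cone `P`; the sign of `1` is `-1`. -/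
noncomputable def coneSign {G : Type*} (P : Set G) (x : G) : ℤ := if x ∈ P then 1 else -1

section coneSign

variable {G : Type*} {P : Set G} {x y : G}

theorem coneSign_of_mem (hx : x ∈ P) : coneSign P x = 1 := if_pos hx

theorem coneSign_of_notMem (hx : x ∉ P) : coneSign P x = -1 := if_neg hx

theorem coneSign_eq_or (P : Set G) (x : G) : coneSign P x = 1 ∨ coneSign P x = -1 := by
  by_cases hx : x ∈ P
  · exact .inl (coneSign_of_mem hx)
  · exact .inr (coneSign_of_notMem hx)

theorem odd_coneSign (P : Set G) (x : G) : Odd (coneSign P x) := by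
  rcases coneSign_eq_or P x with h | h <;> rw [h] <;> decide

theorem IsPositiveCone.coneSign_inv [Group G] (hP : IsPositiveCone P) (hx : x ≠ 1) :
    coneSign P x⁻¹ = -coneSign P x := by
  by_cases h : x ∈ P
  · rw [coneSign_of_mem h, coneSign_of_notMem (hP.inv_notMem h)]
  · rw [coneSign_of_notMem h, coneSign_of_mem ((hP.mem_or_inv_mem hx).resolve_left h), neg_neg]

theorem IsPositiveCone.coneSign_mul [Group G] (hP : IsPositiveCone P) (hx : x ≠ 1) (hy : y ≠ 1)
    (hxy : coneSign P x = coneSign P y) : coneSign P (x * y) = coneSign P x := by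
  by_cases hxP : x ∈ P <;> by_cases hyP : y ∈ P
  · rw [coneSign_of_mem hxP, coneSign_of_mem (hP.mul_mem hxP hyP)]
  · rw [coneSign_of_mem hxP, coneSign_of_notMem hyP] at hxy
    lia
  · rw [coneSign_of_notMem hxP, coneSign_of_mem hyP] at hxy
    lia
  · have hinv : (x * y)⁻¹ ∈ P := by
      rw [mul_inv_rev]
      exact hP.mul_mem ((hP.mem_or_inv_mem hy).resolve_left hyP)
        ((hP.mem_or_inv_mem hx).resolve_left hxP)
    rw [coneSign_of_notMem hxP, coneSign_of_notMem (by simpa using hP.inv_notMem hinv)]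

theorem IsPositiveCone.abs_coneSign_inv_mul_le [Group G] (hP : IsPositiveCone P) (hx : x ≠ 1)
    (hy : y ≠ 1) : |coneSign P (x⁻¹ * y) - (coneSign P y - coneSign P x)| ≤ 1 := by
  have hinv := hP.coneSign_inv hx
  have hmul := hP.coneSign_mul (inv_ne_one.2 hx) hy
  rw [abs_le]
  rcases coneSign_eq_or P x with h₁ | h₁ <;> rcases coneSign_eq_or P y with h₂ | h₂ <;>
    rcases coneSign_eq_or P (x⁻¹ * y) with h₃ | h₃ <;> simp_all

end coneSign

/-- A quasimorphism of defect at most `1` that is an odd function and takes odd values away from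
the identity. -/
structure IsOddQuasimorphism {H : Type*} [Group H] (W : H → ℤ) : Prop where
  map_inv : ∀ g, W g⁻¹ = -W g
  odd : ∀ {g}, g ≠ 1 → Odd (W g)
  abs_map_mul_sub_le : ∀ g h, |W (g * h) - (W g + W h)| ≤ 1

/-- The extension of `W` to the product with the infinite cyclic group, on which the generator has
level `2`, so that the levels of the elements over a nontrivial `g` are distinct odd numbers. -/
def level {H : Type*} (W : H → ℤ) (g : H × Multiplicative ℤ) : ℤ :=
  W g.1 + 2 * g.2.toAdd

namespace IsOddQuasimorphism

variable {H : Type*} [Group H] {W : H → ℤ}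

theorem map_one (hW : IsOddQuasimorphism W) : W 1 = 0 := by
  have h := hW.map_inv 1
  rw [inv_one] at h
  lia

theorem isPositiveCone (hW : IsOddQuasimorphism W) : IsPositiveCone {g | 0 < level W g} where
  one_notMem := by simp [level, hW.map_one]
  mul_mem {a b} ha hb := by
    have hab := abs_le.1 (hW.abs_map_mul_sub_le a.1 b.1)
    simp only [level, Set.mem_ofPred_eq, Prod.fst_mul, Prod.snd_mul, toAdd_mul] at *
    lia
  mem_or_inv_mem {a} ha := by
    have hlevel : level W a ≠ 0 := by
      intro h
      rcases eq_or_ne a.1 1 with h₁ | h₁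
      · refine ha (Prod.ext h₁ (toAdd_eq_zero.1 ?_))
        simpa [level, h₁, hW.map_one] using h
      · obtain ⟨m, hm⟩ := hW.odd h₁
        simp only [level] at h
        lia
    have hinv : level W a⁻¹ = -level W a := by
      simp only [level, Prod.fst_inv, Prod.snd_inv, hW.map_inv, toAdd_inv]
      ring
    rcases hlevel.lt_or_gt with h | h
    · exact .inr (by simpa [hinv] using h)
    · exact .inl h

/-- Modulo powers of the generator of the cyclic factor, a positive element has level `1`, unless
it is itself such a power. -/
theorem setOf_level_pos_eq (hW : IsOddQuasimorphism W) :
    {g | 0 < level W g} = ({(1, ofAdd 1)} ∪ {g | level W g = 1}) *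
      (Submonoid.closure {((1, ofAdd 1) : H × Multiplicative ℤ)} : Set _) := by
  have hpow : ∀ n : ℕ, ((1, ofAdd 1) : H × Multiplicative ℤ) ^ n = (1, ofAdd (n : ℤ)) := by
    intro n
    simp [Prod.pow_def, ← ofAdd_nsmul]
  ext ⟨g, k⟩
  simp only [Set.mem_mul, SetLike.mem_coe, Submonoid.mem_closure_singleton, hpow,
    Set.mem_ofPred_eq, exists_exists_eq_and, Set.mem_union, Set.mem_singleton_iff]
  constructor
  · intro h
    have hdiv : ∀ {a : ℤ}, 0 ≤ k.toAdd - a →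
        (g, ofAdd a) * (1, ofAdd ((k.toAdd - a).toNat : ℤ)) = (g, k) := by
      intro a ha
      rw [Int.toNat_of_nonneg ha, Prod.mk_mul_mk, mul_one, ← ofAdd_add, add_sub_cancel, ofAdd_toAdd]
    rcases eq_or_ne g 1 with rfl | hg
    · simp only [level, hW.map_one] at h
      exact ⟨_, .inl rfl, _, hdiv (by lia)⟩
    · obtain ⟨m, hm⟩ := hW.odd hg
      simp only [level] at h
      exact ⟨(g, ofAdd (-m)), .inr (by simp [level, hm]), _, hdiv (by lia)⟩
  · rintro ⟨a, ha, n, hgk⟩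
    have hlevel : level W (g, k) = level W a + 2 * n := by
      rw [← hgk]
      simp only [level, Prod.fst_mul, Prod.snd_mul, mul_one, toAdd_mul, toAdd_ofAdd]
      ring
    have ha' : 0 < level W a := by
      rcases ha with rfl | ha
      · simp [level, hW.map_one]
      · lia
    lia

theorem hasRationalPositiveCone (hW : IsOddQuasimorphism W) (hr : IsRational {g | level W g = 1}) :
    HasRationalPositiveCone (H × Multiplicative ℤ) := by
  refine ⟨_, hW.isPositiveCone, ?_⟩
  rw [hW.setOf_level_pos_eq]
  exact ((IsRational.of_finite (Set.finite_singleton _)).union hr).mul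
    (.closure (.of_finite (Set.finite_singleton _)))

end IsOddQuasimorphism

theorem IsRational.prod_singleton {M N : Type*} [Monoid M] [Monoid N] {S : Set M}
    (hS : IsRational S) (b : N) : IsRational (S ×ˢ {b}) := by
  have hprod : S ×ˢ {b} = MonoidHom.inl M N '' S * {(1, b)} := by
    ext ⟨a, c⟩
    simp [eq_comm]
  rw [hprod]
  exact (hS.map _).mul (.of_finite (Set.finite_singleton _))

/-- `1` for an ascent from `a` to `b`, `-1` for a descent and `0` if `a = b`. -/
def jump {α : Type*} [LinearOrder α] (a b : α) : ℤ :=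
  if a < b then 1 else if b < a then -1 else 0

section jump

variable {α : Type*} [LinearOrder α]

theorem jump_of_lt {a b : α} (hab : a < b) : jump a b = 1 := if_pos hab

theorem jump_self (a : α) : jump a a = 0 := by simp [jump]

theorem jump_swap (a b : α) : jump a b = -jump b a := by
  rcases lt_trichotomy a b with h | rfl | h
  · simp [jump, h, h.not_gt]
  · simp [jump_self]
  · simp [jump, h, h.not_gt]

theorem odd_jump {a b : α} (hab : a ≠ b) : Odd (jump a b) := by
  rcases hab.lt_or_gt with h | h
  · simp [jump_of_lt h]
  · simp [jump_swap a b, jump_of_lt h]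

theorem abs_jump_cycle_le (a b c : α) : |jump a b + jump b c + jump c a| ≤ 1 := by
  grind [jump]

end jump

open Monoid (CoprodI)

namespace FreeProductOrder

section Head

variable {ι : Type*} {G : ι → Type*} [∀ i, Group (G i)]

open Classical in
/-- The reduced word representing an element of a free product. -/
noncomputable def normalForm (g : CoprodI G) : CoprodI.Word G :=
  CoprodI.Word.equiv g

theorem normalForm_prod (w : CoprodI.Word G) : normalForm w.prod = w := by
  classical exact CoprodI.Word.equiv.apply_symm_apply w

theorem prod_normalForm (g : CoprodI G) : (normalForm g).prod = g := by
  classical exact CoprodI.Word.equiv.symm_apply_apply g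

theorem normalForm_one : normalForm (1 : CoprodI G) = .empty :=
  normalForm_prod .empty

/-- The index of the first syllable of the reduced word representing `g`, and `⊤` if `g = 1`. -/
noncomputable def head (g : CoprodI G) : WithTop ι :=
  (normalForm g).fstIdx.elim ⊤ (↑)

theorem head_eq_coe_iff {g : CoprodI G} {i : ι} :
    head g = i ↔ (normalForm g).fstIdx = some i := by
  unfold head
  cases (normalForm g).fstIdx <;> simp

variable {i : ι} {x : G i} {g : CoprodI G}

theorem normalForm_of_mul (hx : x ≠ 1) (hg : head g ≠ i) :
    normalForm (CoprodI.of x * g) = .cons x (normalForm g) (mt head_eq_coe_iff.2 hg) hx := by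
  conv_lhs => rw [← prod_normalForm g, ← CoprodI.Word.prod_cons i x _ hx (mt head_eq_coe_iff.2 hg)]
  exact normalForm_prod _

theorem head_one : head (1 : CoprodI G) = ⊤ := by
  rw [head, normalForm_one]
  rfl

theorem head_of_mul (hx : x ≠ 1) (hg : head g ≠ i) : head (CoprodI.of x * g) = i := by
  rw [head_eq_coe_iff, normalForm_of_mul hx hg, CoprodI.Word.fstIdx_cons]

theorem induction_reduced {motive : CoprodI G → Prop} (g : CoprodI G) (one : motive 1)
    (of_mul : ∀ {i} (x : G i) (g), x ≠ 1 → head g ≠ i → motive g → motive (CoprodI.of x * g)) :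
    motive g := by
  rw [← prod_normalForm g]
  induction normalForm g using CoprodI.Word.consRecOn with
  | empty => exact one
  | cons i x w hw hx ih =>
    rw [CoprodI.Word.prod_cons]
    refine of_mul x w.prod hx ?_ ih
    rwa [Ne, head_eq_coe_iff, normalForm_prod]

theorem eq_one_of_head_eq_top (hg : head g = ⊤) : g = 1 := by
  cases g using induction_reduced with
  | one => rfl
  | of_mul x g hx hg' => simp [head_of_mul hx hg'] at hg

theorem exists_eq_of_mul (hg : head g = i) :
    ∃ (x : G i) (h : CoprodI G), x ≠ 1 ∧ head h ≠ i ∧ CoprodI.of x * h = g := by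
  cases g using induction_reduced with
  | one => simp [head_one] at hg
  | of_mul x h hx hh =>
    rw [head_of_mul hx hh, WithTop.coe_inj] at hg
    subst hg
    exact ⟨x, h, hx, hh, rfl⟩

end Head

section Syllables

variable {ι : Type*} {G : ι → Type*} [∀ i, Group (G i)] {P : ∀ i, Set (G i)}

/-- The elements `(x, k)` of the product of the free product with the infinite cyclic group, where
`x` is a nontrivial element of the `i`-th factor and `k` cancels the sign of `x` and `d`. -/
def syllables (P : ∀ i, Set (G i)) (i : ι) (d : ℤ) : Set (CoprodI G × Multiplicative ℤ) :=
  {a | ∃ x : G i, x ≠ 1 ∧ CoprodI.of x = a.1 ∧ coneSign (P i) x + d + 2 * a.2.toAdd = 0}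

theorem syllables_eq (hP : ∀ i, IsPositiveCone (P i)) (i : ι) (m : ℤ) :
    syllables P i (2 * m + 1) = (CoprodI.of '' P i) ×ˢ {ofAdd (-m - 1)} ∪
      (CoprodI.of '' (P i)⁻¹) ×ˢ {ofAdd (-m)} := by
  ext ⟨g, k⟩
  constructor
  · rintro ⟨x, hx, rfl, hk⟩
    by_cases hxP : x ∈ P i
    · rw [coneSign_of_mem hxP] at hk
      refine .inl ⟨⟨x, hxP, rfl⟩, Multiplicative.toAdd.injective ?_⟩
      simp only [toAdd_ofAdd]
      lia
    · rw [coneSign_of_notMem hxP] at hk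
      refine .inr ⟨⟨x, ((hP i).mem_or_inv_mem hx).resolve_left hxP, rfl⟩,
        Multiplicative.toAdd.injective ?_⟩
      simp only [toAdd_ofAdd]
      lia
  · rintro (⟨⟨x, hx, rfl⟩, rfl⟩ | ⟨⟨x, hx, rfl⟩, rfl⟩)
    · refine ⟨x, ?_, rfl, ?_⟩
      · rintro rfl
        exact (hP i).one_notMem hx
      · simp only [coneSign_of_mem hx, toAdd_ofAdd]
        ring
    · have hxP : x ∉ P i := by simpa using (hP i).inv_notMem hx
      refine ⟨x, ?_, rfl, ?_⟩
      · rintro rfl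
        exact (hP i).one_notMem (inv_one (G := G i) ▸ hx)
      · simp only [coneSign_of_notMem hxP, toAdd_ofAdd]
        ring

theorem isRational_syllables (hP : ∀ i, IsPositiveCone (P i)) (hr : ∀ i, IsRational (P i)) (i : ι)
    {d : ℤ} (hd : Odd d) : IsRational (syllables P i d) := by
  obtain ⟨m, rfl⟩ := hd
  rw [syllables_eq hP]
  exact (((hr i).map CoprodI.of).prod_singleton _).union
    (((hr i).inv.map CoprodI.of).prod_singleton _)

end Syllables

variable {ι : Type*} [LinearOrder ι] {G : ι → Type*} [∀ i, Group (G i)] (P : ∀ i, Set (G i))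

/-- The sum of the signs of the syllables of a word and of the jumps between consecutive indices,
the index sequence being preceded by `c` and followed by `⊤`. -/
noncomputable def wordWeight : WithTop ι → List (Σ i, G i) → ℤ
  | c, [] => jump c ⊤
  | c, x :: l => jump c x.1 + coneSign (P x.1) x.2 + wordWeight x.1 l

/-- The weight `wordWeight` of the reduced word representing `g`. -/
noncomputable def weightFrom (c : WithTop ι) (g : CoprodI G) : ℤ :=
  wordWeight P c (normalForm g).toList

variable {i : ι} {x : G i} {g h : CoprodI G}

theorem weightFrom_one (c : WithTop ι) : weightFrom P c (1 : CoprodI G) = jump c ⊤ := by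
  rw [weightFrom, normalForm_one]
  rfl

theorem weightFrom_of_mul (c : WithTop ι) (hx : x ≠ 1) (hg : head g ≠ i) :
    weightFrom P c (CoprodI.of x * g) = jump c i + coneSign (P i) x + weightFrom P i g := by
  rw [weightFrom, normalForm_of_mul hx hg]
  rfl

theorem weightFrom_eq_jump_add (c : WithTop ι) (g : CoprodI G) :
    weightFrom P c g = jump c (head g) + weightFrom P (head g) g := by
  induction g using induction_reduced with
  | one => simp [weightFrom_one, head_one, jump_self]
  | of_mul x g hx hg _ => simp [weightFrom_of_mul, hx, hg, head_of_mul, jump_self, add_assoc]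

theorem odd_weightFrom {c : WithTop ι} (hc : head g ≠ c) : Odd (weightFrom P c g) := by
  induction g using induction_reduced generalizing c with
  | one =>
    rw [weightFrom_one]
    exact odd_jump (head_one (G := G) ▸ hc.symm)
  | of_mul x g hx hg ih =>
    rw [head_of_mul hx hg] at hc
    rw [weightFrom_of_mul P c hx hg]
    exact ((odd_jump hc.symm).add_odd (odd_coneSign _ x)).add_odd (ih hg)

variable {P}

theorem weightFrom_top_inv_mul_of_head_ne (hP : ∀ i, IsPositiveCone (P i))
    (hgh : head g ≠ head h) :
    weightFrom P ⊤ (g⁻¹ * h) = weightFrom P (head g) h - weightFrom P (head g) g := by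
  induction g using induction_reduced generalizing h with
  | one => simp [head_one, weightFrom_one, jump_self]
  | @of_mul i x g hx hg ih =>
    have hx' : x⁻¹ ≠ 1 := inv_ne_one.2 hx
    rw [head_of_mul hx hg] at hgh ⊢
    have hhead : head (CoprodI.of x⁻¹ * h) = i := head_of_mul hx' hgh.symm
    have ih' := ih (h := CoprodI.of x⁻¹ * h) (hhead ▸ hg)
    rw [weightFrom_of_mul P _ hx' hgh.symm, (hP i).coneSign_inv hx] at ih'
    rw [mul_inv_rev, mul_assoc, ← map_inv, ih', weightFrom_of_mul P i hx hg, jump_self,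
      weightFrom_eq_jump_add P i g, jump_swap (head g)]
    ring

theorem weightFrom_top_inv_mul_of_head_eq (hP : ∀ i, IsPositiveCone (P i)) {y : G i}
    (hxy : x ≠ y) (hg : head g ≠ i) (hh : head h ≠ i) :
    weightFrom P ⊤ ((CoprodI.of x * g)⁻¹ * (CoprodI.of y * h)) =
      coneSign (P i) (x⁻¹ * y) + weightFrom P i h - weightFrom P i g := by
  have hz : x⁻¹ * y ≠ 1 := mt inv_mul_eq_one.1 hxy
  have hhead : head g ≠ head (CoprodI.of (x⁻¹ * y) * h) := by rwa [head_of_mul hz hh]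
  have hcancel :
      (CoprodI.of x * g)⁻¹ * (CoprodI.of y * h) = g⁻¹ * (CoprodI.of (x⁻¹ * y) * h) := by
    simp only [mul_inv_rev, map_mul, map_inv, mul_assoc]
  rw [hcancel, weightFrom_top_inv_mul_of_head_ne hP hhead, weightFrom_of_mul P _ hz hh,
    weightFrom_eq_jump_add P i g, jump_swap (head g)]
  ring

theorem abs_weightFrom_top_inv_mul_sub_le_of_head_ne (hP : ∀ i, IsPositiveCone (P i))
    (c : WithTop ι) (hgh : head g ≠ head h) :
    |weightFrom P ⊤ (g⁻¹ * h) - (weightFrom P c h - weightFrom P c g)| ≤ 1 := by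
  convert abs_jump_cycle_le (head g) (head h) c using 2
  rw [weightFrom_top_inv_mul_of_head_ne hP hgh, weightFrom_eq_jump_add P (head g) h,
    weightFrom_eq_jump_add P c h, weightFrom_eq_jump_add P c g, jump_swap (head h) c]
  ring

theorem abs_weightFrom_top_inv_mul_sub_le (hP : ∀ i, IsPositiveCone (P i)) (c : WithTop ι)
    (g h : CoprodI G) :
    |weightFrom P ⊤ (g⁻¹ * h) - (weightFrom P c h - weightFrom P c g)| ≤ 1 := by
  induction g using induction_reduced generalizing c h with
  | one =>
    rcases eq_or_ne h 1 with rfl | hh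
    · simp [weightFrom_one, jump_self]
    · exact abs_weightFrom_top_inv_mul_sub_le_of_head_ne hP c
        (head_one.trans_ne (Ne.symm (mt eq_one_of_head_eq_top hh)))
  | @of_mul i x g hx hg ih =>
    rcases eq_or_ne (head h) i with hh | hh
    · obtain ⟨y, h, hy, hh', rfl⟩ := exists_eq_of_mul hh
      rw [weightFrom_of_mul P c hx hg, weightFrom_of_mul P c hy hh']
      rcases eq_or_ne x y with rfl | hxy
      · simpa [mul_assoc] using ih i h
      · rw [weightFrom_top_inv_mul_of_head_eq hP hxy hg hh']
        convert (hP i).abs_coneSign_inv_mul_le hx hy using 2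
        ring
    · exact abs_weightFrom_top_inv_mul_sub_le_of_head_ne hP c ((head_of_mul hx hg).trans_ne hh.symm)

theorem weightFrom_top_inv (hP : ∀ i, IsPositiveCone (P i)) (g : CoprodI G) :
    weightFrom P ⊤ g⁻¹ = -weightFrom P ⊤ g := by
  rcases eq_or_ne g 1 with rfl | hg
  · simp [weightFrom_one, jump_self]
  · have hhead : head g ≠ head 1 := head_one (G := G) ▸ mt eq_one_of_head_eq_top hg
    have h := weightFrom_top_inv_mul_of_head_ne hP hhead
    rw [mul_one, weightFrom_one] at h
    rw [h, weightFrom_eq_jump_add P ⊤ g, jump_swap ⊤]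
    ring

theorem isOddQuasimorphism_weightFrom_top (hP : ∀ i, IsPositiveCone (P i)) :
    IsOddQuasimorphism (weightFrom P ⊤) where
  map_inv := weightFrom_top_inv hP
  odd hg := odd_weightFrom P (mt eq_one_of_head_eq_top hg)
  abs_map_mul_sub_le g h := by
    have hgh := abs_weightFrom_top_inv_mul_sub_le hP ⊤ g⁻¹ h
    rw [inv_inv, weightFrom_top_inv hP] at hgh
    convert hgh using 2
    ring

/-- The labels of an automaton whose state is the index of the last syllable that has been read,
and `⊤` outside of words. Reading a syllable also adds an element of the cyclic factor that keeps
the total weight constant, up to the last jump to `⊤`. -/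
def edgeLabels (P : ∀ i, Set (G i)) (c d : WithTop ι) : Set (CoprodI G × Multiplicative ℤ) :=
  {a | c ≠ d ∧ (d = ⊤ ∧ a = 1 ∨ ∃ i : ι, d = i ∧ a ∈ syllables P i (jump c i))}

theorem isRational_edgeLabels (hP : ∀ i, IsPositiveCone (P i)) (hr : ∀ i, IsRational (P i))
    (c d : WithTop ι) : IsRational (edgeLabels P c d) := by
  rcases eq_or_ne c d with rfl | hcd
  · simpa [edgeLabels] using IsRational.of_finite Set.finite_empty
  cases d with
  | top => simpa [edgeLabels, hcd] using IsRational.of_finite (Set.finite_singleton 1)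
  | coe i => simpa [edgeLabels, hcd] using isRational_syllables hP hr i (odd_jump hcd)

theorem of_mem_pathLabels_edgeLabels {c : WithTop ι} {a : CoprodI G × Multiplicative ℤ}
    (ha : a ∈ pathLabels (edgeLabels P) {⊤}ᶜ c ⊤) :
    head a.1 ≠ c ∧ weightFrom P c a.1 + 2 * a.2.toAdd = 1 := by
  induction ha with
  | @single c _ ha =>
    obtain ⟨hc, ⟨-, rfl⟩ | ⟨i, hi, -⟩⟩ := ha
    · simp [head_one, hc.symm, weightFrom_one, jump_of_lt (lt_top_iff_ne_top.2 hc)]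
    · exact absurd hi WithTop.top_ne_coe
  | @cons c r a b ha hr _ ih =>
    obtain ⟨hc, ⟨rfl, -⟩ | ⟨i, rfl, x, hx, hxa, hk⟩⟩ := ha
    · exact absurd rfl hr
    · rw [Prod.fst_mul, ← hxa, head_of_mul hx ih.1, weightFrom_of_mul P c hx ih.1, Prod.snd_mul,
        toAdd_mul]
      exact ⟨hc.symm, by linarith [ih.2]⟩

theorem mem_pathLabels_edgeLabels {c : WithTop ι} {k : Multiplicative ℤ} (hc : head g ≠ c)
    (hk : weightFrom P c g + 2 * k.toAdd = 1) :
    (g, k) ∈ pathLabels (edgeLabels P) {⊤}ᶜ c ⊤ := by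
  induction g using induction_reduced generalizing c k with
  | one =>
    have hcT : c ≠ ⊤ := hc.symm.trans_eq head_one
    rw [weightFrom_one, jump_of_lt (lt_top_iff_ne_top.2 hcT)] at hk
    obtain rfl : k = 1 := toAdd_eq_zero.1 (by lia)
    exact .single ⟨hcT, .inl ⟨rfl, rfl⟩⟩
  | @of_mul i x g hx hg ih =>
    rw [head_of_mul hx hg] at hc
    rw [weightFrom_of_mul P c hx hg] at hk
    obtain ⟨l, hl⟩ := (odd_coneSign (P i) x).add_odd (odd_jump hc.symm)
    have hsyllable : (CoprodI.of x, ofAdd (-l)) ∈ syllables P i (jump c i) :=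
      ⟨x, hx, rfl, by rw [hl, toAdd_ofAdd]; ring⟩
    have htail : weightFrom P i g + 2 * (k * ofAdd l).toAdd = 1 := by
      rw [toAdd_mul, toAdd_ofAdd]
      lia
    have hsplit : (CoprodI.of x * g, k) = (CoprodI.of x, ofAdd (-l)) * (g, k * ofAdd l) := by
      simp [mul_comm k]
    rw [hsplit]
    exact .cons ⟨hc.symm, .inr ⟨i, rfl, hsyllable⟩⟩ WithTop.coe_ne_top (ih hg htail)

theorem setOf_level_weightFrom_eq_one (P : ∀ i, Set (G i)) :
    {a | level (weightFrom P ⊤) a = 1} = pathLabels (edgeLabels P) {⊤}ᶜ ⊤ ⊤ := by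
  ext ⟨g, k⟩
  refine ⟨fun hlevel => mem_pathLabels_edgeLabels (fun hg => ?_) hlevel,
    fun h => (of_mem_pathLabels_edgeLabels h).2⟩
  have h : weightFrom P ⊤ g + 2 * k.toAdd = 1 := hlevel
  rw [eq_one_of_head_eq_top hg, weightFrom_one, jump_self] at h
  lia

theorem isRational_setOf_level_weightFrom_eq_one [Finite ι] (hP : ∀ i, IsPositiveCone (P i))
    (hr : ∀ i, IsRational (P i)) : IsRational {a | level (weightFrom P ⊤) a = 1} := by
  rw [setOf_level_weightFrom_eq_one]
  exact isRational_pathLabels (Set.toFinite _) (isRational_edgeLabels hP hr) ⊤ ⊤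

end FreeProductOrder

theorem HasRationalPositiveCone.coprodI_prod_int {ι : Type*} [Finite ι] {G : ι → Type*}
    [∀ i, Group (G i)] (hG : ∀ i, HasRationalPositiveCone (G i)) :
    HasRationalPositiveCone (CoprodI G × Multiplicative ℤ) := by
  choose P hP hr using hG
  classical
  let _ : LinearOrder ι := linearOrderOfSTO WellOrderingRel
  exact (FreeProductOrder.isOddQuasimorphism_weightFrom_top hP).hasRationalPositiveCone
    (FreeProductOrder.isRational_setOf_level_weightFrom_eq_one hP hr)

namespace RightAngledArtinGroup

variable {V W : Type*} {Γ : SimpleGraph V} {Δ : SimpleGraph W}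

/-- The generator belonging to a vertex. -/
def of (Γ : SimpleGraph V) (a : V) : RightAngledArtinGroup Γ := PresentedGroup.of a

theorem commute_of_of {a b : V} (h : Γ.Adj a b) : Commute (of Γ a) (of Γ b) :=
  PresentedGroup.mk_eq_mk_of_mul_inv_mem (rels := raagRelators Γ) ⟨a, b, h, rfl⟩

/-- The homomorphism with given values on the vertices, those at adjacent vertices commuting. -/
def lift {H : Type*} [Group H] (f : V → H) (hf : ∀ {a b}, Γ.Adj a b → Commute (f a) (f b)) :
    RightAngledArtinGroup Γ →* H :=
  PresentedGroup.toGroup (f := f) <| by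
    rintro _ ⟨a, b, h, rfl⟩
    simp only [map_mul, map_inv, FreeGroup.lift_apply_of]
    rw [(hf h).eq, mul_inv_cancel]

@[simp]
theorem lift_of {H : Type*} [Group H] (f : V → H)
    (hf : ∀ {a b}, Γ.Adj a b → Commute (f a) (f b)) (a : V) : lift f hf (of Γ a) = f a :=
  PresentedGroup.toGroup.of _

theorem hom_ext {H : Type*} [Group H] {f g : RightAngledArtinGroup Γ →* H}
    (h : ∀ a, f (of Γ a) = g (of Γ a)) : f = g :=
  PresentedGroup.ext h

instance [Finite V] : Group.FG (RightAngledArtinGroup Γ) :=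
  Group.fg_iff.2 ⟨_, PresentedGroup.closure_range_of _, Set.finite_range _⟩

/-- The homomorphism of right-angled Artin groups induced by a homomorphism of graphs. -/
def map (f : Γ →g Δ) : RightAngledArtinGroup Γ →* RightAngledArtinGroup Δ :=
  lift (fun a => of Δ (f a)) fun h => commute_of_of (f.map_adj h)

@[simp]
theorem map_of (f : Γ →g Δ) (a : V) : map f (of Γ a) = of Δ (f a) :=
  lift_of _ (fun h => commute_of_of (f.map_adj h)) a

section Fibres

variable {ι : Type*} (φ : V → ι)

/-- The generator belonging to `a`, in the free product of the right-angled Artin groups of the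
fibres of `φ`. -/
def fibreOf (Γ : SimpleGraph V) (a : V) :
    CoprodI fun i => RightAngledArtinGroup (Γ.induce {b | φ b = i}) :=
  CoprodI.of (i := φ a) (of _ ⟨a, rfl⟩)

variable {φ}

theorem fibreOf_eq {a : V} {i : ι} (ha : φ a = i) :
    fibreOf φ Γ a = CoprodI.of (i := i) (of (Γ.induce {b | φ b = i}) ⟨a, ha⟩) := by
  subst ha
  rfl

theorem commute_fibreOf {a b : V} (hab : Γ.Adj a b) (hφ : φ a = φ b) :
    Commute (fibreOf φ Γ a) (fibreOf φ Γ b) := by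
  rw [fibreOf_eq hφ, fibreOf_eq rfl]
  exact (commute_of_of (Γ := Γ.induce {c | φ c = φ b}) (a := ⟨a, hφ⟩) (b := ⟨b, rfl⟩) hab).map _

/-- A graph without edges between the fibres of `φ` yields the free product of the groups of the
fibres. -/
def equivCoprodI (φ : V → ι) (hφ : ∀ {a b}, Γ.Adj a b → φ a = φ b) :
    RightAngledArtinGroup Γ ≃* CoprodI fun i => RightAngledArtinGroup (Γ.induce {a | φ a = i}) :=
  MonoidHom.toMulEquiv (lift (fibreOf φ Γ) fun h => commute_fibreOf h (hφ h))
    (CoprodI.lift fun _ => map (SimpleGraph.Embedding.induce _).toHom)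
    (hom_ext fun a => by simp [fibreOf])
    (CoprodI.ext_hom _ _ fun _ => hom_ext fun a => by simp [fibreOf_eq a.2])

end Fibres

section Universal

variable {v : V}

theorem commute_of_isUniversal (hv : Γ.IsUniversal v) (g : RightAngledArtinGroup Γ) :
    Commute (of Γ v) g := by
  have hconj : (MulAut.conj (of Γ v)).toMonoidHom = .id _ := hom_ext fun a => by
    have h : Commute (of Γ v) (of Γ a) := by
      rcases eq_or_ne v a with rfl | ha
      · exact Commute.refl _
      · exact commute_of_of (hv ha)
    simp [h.eq]
  exact mul_inv_eq_iff_eq_mul.1 (DFunLike.congr_fun hconj g)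

variable (Γ v)

open Classical in
/-- The generator belonging to `a`, in the product of the group of `Γ - v` with the infinite cyclic
group generated by `v`. -/
noncomputable def splitOf (a : V) :
    RightAngledArtinGroup (Γ.induce {a | a ≠ v}) × Multiplicative ℤ :=
  if h : a = v then (1, ofAdd 1) else (of _ ⟨a, h⟩, 1)

theorem splitOf_self : splitOf Γ v v = (1, ofAdd 1) := dif_pos rfl

variable {Γ v}

theorem splitOf_of_ne {a : V} (ha : a ≠ v) :
    splitOf Γ v a = (of (Γ.induce {a | a ≠ v}) ⟨a, ha⟩, 1) := dif_neg ha

theorem commute_splitOf {a b : V} (hab : Γ.Adj a b) :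
    Commute (splitOf Γ v a) (splitOf Γ v b) := by
  rw [Prod.commute_iff]
  refine ⟨?_, Commute.all _ _⟩
  rcases eq_or_ne a v with rfl | ha
  · rw [splitOf_self]
    exact Commute.one_left _
  rcases eq_or_ne b v with rfl | hb
  · rw [splitOf_self]
    exact Commute.one_right _
  rw [splitOf_of_ne ha, splitOf_of_ne hb]
  exact commute_of_of (Γ := Γ.induce {a | a ≠ v}) hab

/-- A universal vertex generates an infinite cyclic direct factor. -/
noncomputable def equivProdInt (hv : Γ.IsUniversal v) :
    RightAngledArtinGroup Γ ≃*
      RightAngledArtinGroup (Γ.induce {a | a ≠ v}) × Multiplicative ℤ :=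
  MonoidHom.toMulEquiv (lift (splitOf Γ v) commute_splitOf)
    (MonoidHom.noncommCoprod (map (SimpleGraph.Embedding.induce _).toHom)
      (zpowersHom _ (of Γ v)) fun _ n => by
        rw [zpowersHom_apply]
        exact ((commute_of_isUniversal hv _).zpow_left n.toAdd).symm)
    (hom_ext fun a => by
      rcases eq_or_ne a v with rfl | ha
      · simp [splitOf_self]
      · simp [splitOf_of_ne ha])
    (by
      rw [MonoidHom.comp_noncommCoprod, ← MonoidHom.noncommCoprod_inl_inr]
      congr 1
      · exact hom_ext fun a => by simp [splitOf_of_ne a.2]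
      · exact MonoidHom.ext_mint (by simp [splitOf_self]))

end Universal

end RightAngledArtinGroup

section Graphs

variable {V : Type*} {Γ : SimpleGraph V} {u v w : V}

theorem exists_adj_adj_not_adj_of_not_isUniversal (hconn : Γ.Preconnected)
    (hv : ¬ Γ.IsUniversal v) : ∃ u w, Γ.Adj v u ∧ Γ.Adj u w ∧ v ≠ w ∧ ¬ Γ.Adj v w := by
  obtain ⟨a, hva, ha⟩ : ∃ a, v ≠ a ∧ ¬ Γ.Adj v a := by simpa [SimpleGraph.IsUniversal] using hv
  obtain ⟨p⟩ := hconn v a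
  obtain ⟨d, -, hfst, hsnd⟩ :=
    p.exists_boundary_dart (insert v (Γ.neighborSet v)) (Set.mem_insert _ _)
      (by simp [hva.symm, ha])
  simp only [Set.mem_insert_iff, SimpleGraph.mem_neighborSet, not_or] at hfst hsnd
  rcases hfst with hfst | hfst
  · exact absurd (hfst ▸ d.adj) hsnd.2
  · exact ⟨d.fst, d.snd, hfst, d.adj, Ne.symm hsnd.1, hsnd.2⟩

theorem exists_adj_not_adj_of_degree_le [Fintype (Γ.neighborSet u)] [Fintype (Γ.neighborSet v)]
    (hdeg : Γ.degree u ≤ Γ.degree v) (hvu : Γ.Adj v u) (huw : Γ.Adj u w) (hvw : v ≠ w)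
    (hvw' : ¬ Γ.Adj v w) : ∃ x, Γ.Adj x v ∧ x ≠ u ∧ ¬ Γ.Adj x u := by
  classical
  by_contra! hnbr
  have hssub : insert v ((Γ.neighborFinset v).erase u) ⊂ Γ.neighborFinset u := by
    refine (Finset.ssubset_iff_of_subset fun x hx => ?_).2 ⟨w, by simpa using huw, ?_⟩
    · rw [Finset.mem_insert, Finset.mem_erase, SimpleGraph.mem_neighborFinset] at hx
      rw [SimpleGraph.mem_neighborFinset]
      rcases hx with rfl | ⟨hxu, hvx⟩
      · exact hvu.symm
      · exact (hnbr x hvx.symm hxu).symm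
    · simp [hvw.symm, hvw']
  have hcard := Finset.card_lt_card hssub
  rw [Finset.card_insert_of_notMem (by simp), Finset.card_erase_add_one (by simpa using hvu),
    Γ.card_neighborFinset_eq_degree, Γ.card_neighborFinset_eq_degree] at hcard
  lia

end Graphs

/-- A graph without an induced cycle on four vertices and without an induced path on four vertices,
which is also called a quasi-threshold graph. -/
def IsTriviallyPerfect {V : Type*} (Γ : SimpleGraph V) : Prop :=
  ¬ (SimpleGraph.cycleGraph 4).IsIndContained Γ ∧ ¬ (SimpleGraph.pathGraph 4).IsIndContained Γ

namespace IsTriviallyPerfect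

variable {V W : Type*} {Γ : SimpleGraph V} {Δ : SimpleGraph W}

theorem of_isIndContained (hΓ : IsTriviallyPerfect Γ) (h : Δ.IsIndContained Γ) :
    IsTriviallyPerfect Δ :=
  ⟨fun h' => hΓ.1 (h'.trans h), fun h' => hΓ.2 (h'.trans h)⟩

theorem adj_of_path {x v u w : V} (hΓ : IsTriviallyPerfect Γ) (hxv : Γ.Adj x v) (hvu : Γ.Adj v u)
    (huw : Γ.Adj u w) (hxu : x ≠ u) (hxu' : ¬ Γ.Adj x u) (hvw : v ≠ w) : Γ.Adj v w := by
  by_contra hvw'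
  have hxw : x ≠ w := by
    rintro rfl
    exact hvw' hxv.symm
  have hinj : Function.Injective ![x, v, u, w] := by
    have := hxv.ne
    have := hvu.ne
    have := huw.ne
    intro i j
    fin_cases i <;> fin_cases j <;> simp <;> grind
  by_cases hadj : Γ.Adj x w
  · have hcycle (i j : Fin 4) : (SimpleGraph.cycleGraph 4).Adj i j ↔ i + 1 = j ∨ j + 1 = i := by
      decide +revert
    refine hΓ.1 ⟨⟨⟨![x, v, u, w], hinj⟩, fun {i j} => ?_⟩⟩
    fin_cases i <;> fin_cases j <;>
      simp [ Γ.adj_comm, *]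
  · refine hΓ.2 ⟨⟨⟨![x, v, u, w], hinj⟩, fun {i j} => ?_⟩⟩
    fin_cases i <;> fin_cases j <;> simp [SimpleGraph.pathGraph_adj, Γ.adj_comm, *]

theorem exists_isUniversal [Finite V] (hΓ : IsTriviallyPerfect Γ) (hconn : Γ.Connected) :
    ∃ v, Γ.IsUniversal v := by
  classical
  have := Fintype.ofFinite V
  have := hconn.nonempty
  obtain ⟨v, hdeg⟩ := Finite.exists_max fun v => Γ.degree v
  refine ⟨v, ?_⟩
  by_contra hv
  obtain ⟨u, w, hvu, huw, hvw, hvw'⟩ :=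
    exists_adj_adj_not_adj_of_not_isUniversal hconn.preconnected hv
  obtain ⟨x, hxv, hxu, hxu'⟩ := exists_adj_not_adj_of_degree_le (hdeg u) hvu huw hvw hvw'
  exact hvw' (hΓ.adj_of_path hxv hvu huw hxu hxu' hvw)

end IsTriviallyPerfect

open RightAngledArtinGroup in
theorem IsTriviallyPerfect.hasRationalPositiveCone {V : Type*} [Finite V] {Γ : SimpleGraph V}
    (hΓ : IsTriviallyPerfect Γ) (hconn : Γ.Connected) :
    HasRationalPositiveCone (RightAngledArtinGroup Γ) := by
  induction hn : Nat.card V using Nat.strong_induction_on generalizing V with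
  | _ n ih =>
    subst hn
    obtain ⟨v, hv⟩ := hΓ.exists_isUniversal hconn
    let Δ := Γ.induce {a | a ≠ v}
    have hcomponent (C : Δ.ConnectedComponent) :
        HasRationalPositiveCone (RightAngledArtinGroup C.toSimpleGraph) := by
      have hsub : C.toSimpleGraph.IsIndContained Γ :=
        ⟨(SimpleGraph.Embedding.induce _).trans (SimpleGraph.Embedding.induce _)⟩
      have hcard : Nat.card C < Nat.card V :=
        (Finite.card_subtype_le _).trans_lt (Finite.card_subtype_lt (x := v) (by simp))
      exact ih _ hcard (hΓ.of_isIndContained hsub) C.connected_toSimpleGraph rfl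
    exact (HasRationalPositiveCone.coprodI_prod_int hcomponent).of_mulEquiv
      ((equivProdInt hv).trans
        ((equivCoprodI Δ.connectedComponentMk
          SimpleGraph.ConnectedComponent.connectedComponentMk_eq_of_adj).prodCongr
          (MulEquiv.refl _))).symm

/-- `SimpleGraph.cycleGraph 4` is the cycle with four edges, and `SimpleGraph.pathGraph 4` is the
path on four vertices, i.e. with three edges. -/
theorem mainTheorem10 {V : Type*} [Finite V] (Γ : SimpleGraph V) (hconn : Γ.Connected)
    (hC4 : ¬ (SimpleGraph.cycleGraph 4).IsIndContained Γ)
    (hL3 : ¬ (SimpleGraph.pathGraph 4).IsIndContained Γ) :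
    ∃ lt : RightAngledArtinGroup Γ → RightAngledArtinGroup Γ → Prop,
      IsRegularLeftOrder lt := by
  have hΓ : IsTriviallyPerfect Γ := ⟨hC4, hL3⟩
  obtain ⟨P, hP, hr⟩ := hΓ.hasRationalPositiveCone hconn
  refine ⟨fun a b => a⁻¹ * b ∈ P, hP.isLeftOrder, ?_⟩
  simpa [positiveCone] using hr.isRegularSubset
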